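/- A (reward-free) POMDP consists of finite sets $S, A, O$, row-stochastic transition matrices $T^a$ ($a\in A$), diagonal observation matrices $Z^{ao}$ with nonnegative entries and $\sum_{o} Z^{ao}=I$, and an initial distribution $b_0$ on $S$; here $T^a_{ij}$ is the probability of moving from $i$ to $j$ under $a$, and $Z^{ao}_{ii}$ the probability of observing $o$ when leaving $i$ under $a$. Under uniform random exploration the actions $a_1,a_2,\dots$ are i.i.d. uniform on $A$, $s_1\sim b_0$, and given the past, $s_t$ and $a_t$, the observation $o_t$ and the state $s_{t+1}$ are drawn independently from $Z^{a_t\,\cdot}_{s_ts_t}$ and $T^{a_t}_{s_t\,\cdot}$. For finite action-observation strings $h,\tau$ with $L=|h\oplus \tau|$, the empirical Hankel matrix of $(a_1,o_1,\dots,a_n,o_n)$ is $$\hat{\mathbb H}^{(n)}_{h,\tau}=\frac{\#\{1\le i\le n-L:\ (a_i,o_i,\dots,a_{i+L-1},o_{i+L-1})=h\oplus \tau\}}{\#\{1\le i\le n-L:\ (a_i,\dots,a_{i+L-1})=\text{the action sequence of } h\oplus \tau\}} .$$ Let $\mathcal M$ be the perturbed Sense-Float-Reset POMDP with $S=\{0,1,2\}$,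 $A=\{\mathrm{float}',\mathrm{reset},\mathrm{sense}\}$, $O=\{0,1\}$, $$T^{\mathrm{float}'}=\begin{pmatrix}.4&.5&.1\\.5&.1&.4\\0&.5&.5\end{pmatrix},\quad T^{\mathrm{reset}}=\begin{pmatrix}1&0&0\\1&0&0\\1&0&0\end{pmatrix},\quad T^{\mathrm{sense}}=I,$$ where $\mathrm{float}'$ always emits $0$, and $\mathrm{reset}$ and $\mathrm{sense}$ emit $1$ in state $0$ and $0$ in states $1,2$. Let $$P=\begin{pmatrix}1&0&0\\0&0&1\\0&.95&.05\end{pmatrix},$$ and let $\mathcal M'$ be the POMDP with the same $S,A,O$ and matrices $T'^a=PT^aP^{-1}$, $Z'^{ao}=PZ^{ao}P^{-1}$ (these matrices do define a POMDP). The initial distributions $b_0$ of $\mathcal M$ and $b_0'$ of $\mathcal M'$ are arbitrary. **Theorem.** (i) $Z'^{ao}=Z^{ao}$ for all $a,o$, and for both POMDPs the observability partition (states are equivalent if they have the same observation distribution under every action) and the full-rank observability partition (the same, for actions with invertible transition matrix only) are $\{\{0\},\{1,2\}\}$. However, for every permutation $\sigma$ of $S$ there are states $i,j$ in a common cell with $T'^{\mathrm{float}'}_{\sigma(i)\sigma(j)}\ne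 T^{\mathrm{float}'}_{ij}$. (ii) There is a deterministic matrix $\mathbb H$, indexed by pairs of finite action-observation strings, such that for all initial distributions $b_0$ and $b_0'$ and under uniform random exploration, almost surely $\hat{\mathbb H}^{(n)}_{h,\tau}\to\mathbb H_{h,\tau}$ for all $h,\tau$ when the data come from $\mathcal M$, and likewise, with the same $\mathbb H$, when the data come from $\mathcal M'$. -/

import Mathlib

open MeasureTheory Filter Topology

/-- A discrete POMDP (without reward), with state set `S`, action set `A`, observation set `O`.
`T a i j` is the probability of moving from `i` to `j` under action `a`; `Z a o` is the diagonal
matrix whose entry at `(i, i)` is the probability of emitting `o` when leaving state `i` under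
action `a`; `b₀` is the initial state distribution. -/
structure POMDP (S A O : Type*) [Fintype S] [DecidableEq S] [Fintype O] where
  b₀ : S → ℝ
  T : A → Matrix S S ℝ
  Z : A → O → Matrix S S ℝ
  b₀_mem : b₀ ∈ stdSimplex ℝ S
  T_mem : ∀ a, T a ∈ Matrix.rowStochastic ℝ S
  Z_diag : ∀ a o, (Z a o).IsDiag
  Z_nonneg : ∀ a o s, 0 ≤ Z a o s s
  Z_sum : ∀ a s, ∑ o, Z a o s s = 1

namespace POMDP

variable {S A O : Type*} [Fintype S] [DecidableEq S] [Fintype O]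

/-- The processes `st` (states), `act` (actions), `obs` (observations) on the probability space
`(Ω, μ)` are a run of the POMDP `M` under uniform memoryless random exploration. The law is given
by its finite-dimensional distributions: the first state has law `b₀`, and at each time an action is
drawn uniformly and independently of the past, then an observation and a next state are emitted,
according to `Z` and `T`, conditionally independently given the current state and action. Time
starts at `0`. -/
structure IsUniformRun [Fintype A] (M : POMDP S A O) {Ω : Type*} [MeasurableSpace Ω]
    (μ : Measure Ω) (st : ℕ → Ω → S) (act : ℕ → Ω → A) (obs : ℕ → Ω → O) : Prop where
  measurable_st : ∀ t x, MeasurableSet {ω | st t ω = x}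
  measurable_act : ∀ t u, MeasurableSet {ω | act t ω = u}
  measurable_obs : ∀ t z, MeasurableSet {ω | obs t ω = z}
  law : ∀ (n : ℕ) (x : ℕ → S) (u : ℕ → A) (z : ℕ → O),
    μ.real {ω | (∀ t < n, st t ω = x t ∧ act t ω = u t ∧ obs t ω = z t) ∧ st n ω = x n} =
      M.b₀ (x 0) * ∏ t ∈ Finset.range n,
        ((1 / (Fintype.card A : ℝ)) * M.Z (u t) (z t) (x t) (x t) * M.T (u t) (x t) (x (t + 1)))

/-- Two states lie in the same cell of the observability partition: they have the same observation
distribution under every action. -/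
def ObsEquiv (M : POMDP S A O) (i j : S) : Prop :=
  ∀ a o, M.Z a o i i = M.Z a o j j

/-- Two states lie in the same cell of the full-rank observability partition: they have the same
observation distribution under every action whose transition matrix has full rank. -/
def FullRankObsEquiv (M : POMDP S A O) (i j : S) : Prop :=
  ∀ a, (M.T a).rank = Fintype.card S → ∀ o, M.Z a o i i = M.Z a o j j

end POMDP

open Classical in
/-- The entry at `(hist, test)` of the empirical Hankel matrix of the data
`(act 0, obs 0), …, (act (n-1), obs (n-1))`: the number of windows that read `hist ⊕ test`, divided
by the number of windows whose actions are those of `hist ⊕ test`. The windows have length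
`L = |hist ⊕ test|` and the first `n - L` starting positions are used. -/
noncomputable def empiricalHankel {A O : Type*} (act : ℕ → A) (obs : ℕ → O) (n : ℕ)
    (hist test : List (A × O)) : ℝ :=
  (((Finset.range (n - (hist ++ test).length)).filter fun i =>
      (List.range (hist ++ test).length).map (fun k => (act (i + k), obs (i + k)))
        = hist ++ test).card : ℝ) /
  (((Finset.range (n - (hist ++ test).length)).filter fun i =>
      (List.range (hist ++ test).length).map (fun k => act (i + k))
        = (hist ++ test).map Prod.fst).card : ℝ)

/-- The actions of the perturbed Sense-Float-Reset POMDP. -/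
inductive SFRAction
  | float'
  | reset
  | sense
  deriving DecidableEq

instance : Fintype SFRAction where
  elems := {.float', .reset, .sense}
  complete := by intro a; cases a <;> decide

/-- The transition matrices of the perturbed 3-state Sense-Float-Reset POMDP; state `0` is the reset
state. -/
noncomputable def sfrT : SFRAction → Matrix (Fin 3) (Fin 3) ℝ
  | .float' => !![0.4, 0.5, 0.1; 0.5, 0.1, 0.4; 0, 0.5, 0.5]
  | .reset => !![1, 0, 0; 1, 0, 0; 1, 0, 0]
  | .sense => !![1, 0, 0; 0, 1, 0; 0, 0, 1]

/-- The diagonal observation matrices of the perturbed 3-state Sense-Float-Reset POMDP: `float'`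
always emits `0`; `reset` and `sense` emit `1` in the reset state and `0` in the other states. -/
noncomputable def sfrZ : SFRAction → Fin 2 → Matrix (Fin 3) (Fin 3) ℝ
  | .float', 0 => !![1, 0, 0; 0, 1, 0; 0, 0, 1]
  | .float', 1 => !![0, 0, 0; 0, 0, 0; 0, 0, 0]
  | .reset, 0 => !![0, 0, 0; 0, 1, 0; 0, 0, 1]
  | .reset, 1 => !![1, 0, 0; 0, 0, 0; 0, 0, 0]
  | .sense, 0 => !![0, 0, 0; 0, 1, 0; 0, 0, 1]
  | .sense, 1 => !![1, 0, 0; 0, 0, 0; 0, 0, 0]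

theorem sfrZ_isDiag (a : SFRAction) (o : Fin 2) : (sfrZ a o).IsDiag := by
  intro i j hij
  cases a <;> fin_cases o <;> fin_cases i <;> fin_cases j <;> simp_all [sfrZ]

/-- The perturbed 3-state Sense-Float-Reset POMDP with initial distribution `b`. -/
noncomputable def perturbedSFR (b : Fin 3 → ℝ) (hb : b ∈ stdSimplex ℝ (Fin 3)) :
    POMDP (Fin 3) SFRAction (Fin 2) where
  b₀ := b
  T := sfrT
  Z := sfrZ
  b₀_mem := hb
  T_mem := by
    intro a
    rw [Matrix.mem_rowStochastic_iff_sum]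
    cases a <;> refine ⟨fun i j => ?_, fun i => ?_⟩ <;> fin_cases i <;>
      (try fin_cases j) <;> norm_num [sfrT, Fin.sum_univ_succ]
  Z_diag := by
    intro a o
    exact sfrZ_isDiag a o
  Z_nonneg := by
    intro a o s
    cases a <;> fin_cases o <;> fin_cases s <;> simp [sfrZ]
  Z_sum := by
    intro a s
    cases a <;> fin_cases s <;> simp [sfrZ]

/-- The similarity transform. -/
noncomputable def simP : Matrix (Fin 3) (Fin 3) ℝ :=
  !![1, 0, 0; 0, 0, 1; 0, 0.95, 0.05]

theorem simP_mem_rowStochastic : simP ∈ Matrix.rowStochastic ℝ (Fin 3) := by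
  rw [Matrix.mem_rowStochastic_iff_sum]
  refine ⟨fun i j => ?_, fun i => ?_⟩ <;> fin_cases i <;>
    (try fin_cases j) <;> norm_num [simP, Fin.sum_univ_succ]

theorem simP_mul_inverse :
    simP * !![1, 0, 0; 0, -1 / 19, 20 / 19; 0, 1, 0] = 1 := by
  ext i j
  fin_cases i <;> fin_cases j <;>
    norm_num [simP, Matrix.mul_apply, Fin.sum_univ_succ]

theorem simP_inv : simP⁻¹ = !![1, 0, 0; 0, -1 / 19, 20 / 19; 0, 1, 0] :=
  Matrix.inv_eq_right_inv simP_mul_inverse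

theorem simP_conj_sfrZ (a : SFRAction) (o : Fin 2) : simP * sfrZ a o * simP⁻¹ = sfrZ a o := by
  rw [simP_inv]
  cases a <;> fin_cases o <;> ext i j <;> fin_cases i <;> fin_cases j <;>
    norm_num [simP, sfrZ, Matrix.mul_apply, Fin.sum_univ_succ]

/-- The image of the perturbed Sense-Float-Reset POMDP under the similarity transform `simP`, with
initial distribution `b'`. -/
noncomputable def transformedSFR (b' : Fin 3 → ℝ) (hb' : b' ∈ stdSimplex ℝ (Fin 3)) :
    POMDP (Fin 3) SFRAction (Fin 2) where
  b₀ := b'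
  T := fun a => simP * sfrT a * simP⁻¹
  Z := fun a o => simP * sfrZ a o * simP⁻¹
  b₀_mem := hb'
  T_mem := by
    intro a
    rw [simP_inv, Matrix.mem_rowStochastic_iff_sum]
    cases a <;> refine ⟨fun i j => ?_, fun i => ?_⟩ <;> fin_cases i <;>
      (try fin_cases j) <;> norm_num [simP, sfrT, Matrix.mul_apply, Fin.sum_univ_succ]
  Z_diag := by
    intro a o
    rw [simP_conj_sfrZ]
    exact sfrZ_isDiag a o
  Z_nonneg := by
    intro a o s
    rw [simP_conj_sfrZ]
    cases a <;> fin_cases o <;> fin_cases s <;> simp [sfrZ]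
  Z_sum := by
    intro a s
    simp only [simP_conj_sfrZ]
    cases a <;> fin_cases s <;> simp [sfrZ]

/-! For (i), `simP` fixes state `0` and mixes `1` and `2`, which all observation matrices treat
alike, so conjugation leaves `sfrZ` unchanged. It does alter the dynamics: the `(1, 1)` entry of the
transformed `float'` matrix is `9 / 19`, a value absent from the diagonal `.4, .1, .5` of the
original, and a relabelling only permutes the diagonal.

For (ii), the expected weight of a window is a product of one-step matrices `weightMatrix` applied
to the constant `1`. All these matrices are conjugated by `simP`, and `simP` fixes constants because
it is row-stochastic, so window values get multiplied by `simP` (`transformedSFR_windowValue`). The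
reset action gives the state chain a Doeblin minorization, so powers of its kernel drive every
function to a constant (`exists_mixesTo_of_reset`), and `simP` leaves that constant unchanged
(`MixesTo.conj`). Both POMDPs thus have the same limiting window frequencies.

Almost sure convergence comes from `ae_tendsto_average_of_correlation_le`. It asks for a geometric
bound on the products `X i * X (i + k)`, with no centring or stationarity, and is applied to window
weights minus their limit; hence the initial distribution is irrelevant. The denominators converge
too, since every action string has the same probability from every state (`windowValue_actions`). -/

/-! ### A strong law from second moments along squares. -/

/-- Partial sums with increments bounded by `B` that are `o(k ^ 2)` along the squares are `o(n)`. -/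
theorem tendsto_div_of_tendsto_sq {s : ℕ → ℝ} {B : ℝ} (hB : ∀ i, |s (i + 1) - s i| ≤ B)
    (h : Tendsto (fun k : ℕ => s (k ^ 2) / (k : ℝ) ^ 2) atTop (𝓝 0)) :
    Tendsto (fun n : ℕ => s n / n) atTop (𝓝 0) := by
  have hB0 : 0 ≤ B := (abs_nonneg _).trans (hB 0)
  have hinc : ∀ m d : ℕ, |s (m + d) - s m| ≤ d * B := by
    intro m d
    induction d with
    | zero => simp
    | succ d ih =>
      have := abs_add_le (s (m + d + 1) - s (m + d)) (s (m + d) - s m)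
      have h2 := hB (m + d)
      rw [sub_add_sub_cancel] at this
      push_cast
      rw [← add_assoc]
      linarith
  have hsqrt : Tendsto Nat.sqrt atTop atTop :=
    tendsto_atTop.2 fun b => eventually_atTop.2 ⟨b * b, fun n hn => Nat.le_sqrt.2 hn⟩
  have h1 : Tendsto (fun n : ℕ => |s (n.sqrt ^ 2) / (n.sqrt : ℝ) ^ 2|) atTop (𝓝 0) := by
    simpa using (h.comp hsqrt).abs
  have h2 : Tendsto (fun n : ℕ => 2 * B * ((n.sqrt : ℝ))⁻¹) atTop (𝓝 0) := by
    simpa using ((tendsto_inv_atTop_zero.comp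
      (tendsto_natCast_atTop_atTop (R := ℝ))).comp hsqrt).const_mul (2 * B)
  have h3 := h1.add h2
  rw [add_zero] at h3
  refine squeeze_zero_norm' ?_ h3
  filter_upwards [eventually_ge_atTop 1] with n hn
  -- Since `r ^ 2 ≤ n ≤ r ^ 2 + 2 * r`, passing from the nearest square to `n` costs at most `2 * r
  -- * B`, which is negligible against `r ^ 2`.
  set r := n.sqrt with hr
  have hr1 : 1 ≤ r := Nat.le_sqrt.2 (by simpa using hn)
  have hle : r ^ 2 ≤ n := Nat.sqrt_le' n
  have hlt : n ≤ r ^ 2 + 2 * r := by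
    have := Nat.sqrt_le_add n
    rw [← hr] at this
    nlinarith
  obtain ⟨d, hd⟩ := Nat.exists_eq_add_of_le hle
  have hd2 : d ≤ 2 * r := by omega
  have hrR : (1 : ℝ) ≤ r := by exact_mod_cast hr1
  have hrpos : (0 : ℝ) < (r : ℝ) ^ 2 := by positivity
  have hnR : (r : ℝ) ^ 2 ≤ n := by exact_mod_cast hle
  have hsn : |s n| ≤ |s (r ^ 2)| + 2 * r * B := by
    have h4 := hinc (r ^ 2) d
    rw [← hd] at h4
    have h5 := abs_add_le (s n - s (r ^ 2)) (s (r ^ 2))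
    rw [sub_add_cancel] at h5
    have h6 : (d : ℝ) * B ≤ 2 * r * B := by
      gcongr
      exact_mod_cast hd2
    linarith
  rw [Real.norm_eq_abs, abs_div, Nat.abs_cast, abs_div, abs_of_pos hrpos]
  calc |s n| / n ≤ (|s (r ^ 2)| + 2 * r * B) / (r : ℝ) ^ 2 := by gcongr
    _ = |s (r ^ 2)| / (r : ℝ) ^ 2 + 2 * B * (r : ℝ)⁻¹ := by
      field_simp

section StrongLaw

variable {Ω : Type*} [MeasurableSpace Ω] {μ : Measure Ω}

/-- The sum of the `Y k` has finite expectation, hence is finite almost everywhere, and the terms of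
a convergent series tend to zero. -/
theorem ae_tendsto_zero_of_summable_integral {Y : ℕ → Ω → ℝ} (hY : ∀ k ω, 0 ≤ Y k ω)
    (hint : ∀ k, Integrable (Y k) μ) (hsum : Summable fun k => ∫ ω, Y k ω ∂μ) :
    ∀ᵐ ω ∂μ, Tendsto (fun k => Y k ω) atTop (𝓝 0) := by
  have hfin : ∫⁻ ω, ∑' k, ENNReal.ofReal (Y k ω) ∂μ ≠ ⊤ := by
    rw [lintegral_tsum fun k => (hint k).aemeasurable.ennreal_ofReal]
    have : ∀ k, ∫⁻ ω, ENNReal.ofReal (Y k ω) ∂μ = ENNReal.ofReal (∫ ω, Y k ω ∂μ) := fun k =>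
      (ofReal_integral_eq_lintegral_ofReal (hint k) (ae_of_all _ (hY k))).symm
    simp_rw [this]
    exact hsum.tsum_ofReal_ne_top
  have hae := ae_lt_top' (AEMeasurable.tsum fun k =>
    (hint k).aemeasurable.ennreal_ofReal) hfin
  filter_upwards [hae] with ω hω
  have h1 := ENNReal.tendsto_atTop_zero_of_tsum_ne_top hω.ne
  have h2 := (ENNReal.tendsto_toReal ENNReal.zero_ne_top).comp h1
  simpa [Function.comp_def, ENNReal.toReal_ofReal (hY _ ω)] using h2

/-- A strong law of large numbers for bounded variables with summable correlations. -/
theorem ae_tendsto_average_of_correlation_le [IsProbabilityMeasure μ] {X : ℕ → Ω → ℝ} {B C ρ : ℝ}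
    (hX : ∀ i, Measurable (X i)) (hB : ∀ i ω, |X i ω| ≤ B) (hρ0 : 0 ≤ ρ) (hρ1 : ρ < 1)
    (hC : ∀ i k, ∫ ω, X i ω * X (i + k) ω ∂μ ≤ C * ρ ^ k) :
    ∀ᵐ ω ∂μ, Tendsto (fun n : ℕ => (∑ i ∈ Finset.range n, X i ω) / n) atTop (𝓝 0) := by
  set s : ℕ → Ω → ℝ := fun n ω => ∑ i ∈ Finset.range n, X i ω with hs
  have hsm : ∀ n, Measurable (s n) := fun n => Finset.measurable_fun_sum _ fun i _ => hX i
  have hsb : ∀ n ω, |s n ω| ≤ n * B := fun n ω => by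
    refine (Finset.abs_sum_le_sum_abs _ _).trans ?_
    refine (Finset.sum_le_sum fun i _ => hB i ω).trans ?_
    simp
  have hintmul : ∀ {f g : Ω → ℝ} {a b : ℝ}, Measurable f → Measurable g → (∀ ω, |f ω| ≤ a) →
      (∀ ω, |g ω| ≤ b) → Integrable (fun ω => f ω * g ω) μ := by
    intro f g a b hf hg ha hb
    refine Integrable.of_bound (hf.mul hg).aestronglyMeasurable (a * b) (ae_of_all _ fun ω => ?_)
    rw [Real.norm_eq_abs, abs_mul]
    exact mul_le_mul (ha ω) (hb ω) (abs_nonneg _) ((abs_nonneg _).trans (ha ω))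
  have hC0 : 0 ≤ C := by
    have := hC 0 0
    simp only [add_zero, pow_zero, mul_one] at this
    exact (integral_nonneg fun ω => mul_self_nonneg _).trans this
  set D := C / (1 - ρ) with hD
  have hcross : ∀ n, ∫ ω, s n ω * X n ω ∂μ ≤ D := by
    intro n
    have h1 : ∫ ω, s n ω * X n ω ∂μ = ∑ i ∈ Finset.range n, ∫ ω, X i ω * X n ω ∂μ := by
      rw [← integral_finsetSum _ fun i _ => hintmul (hX i) (hX n) (hB i) (hB n)]
      simp only [hs, Finset.sum_mul]
    rw [h1]
    have h2 : ∑ i ∈ Finset.range n, ∫ ω, X i ω * X n ω ∂μ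
        ≤ ∑ i ∈ Finset.range n, C * ρ ^ (n - i) := by
      refine Finset.sum_le_sum fun i hi => ?_
      have := hC i (n - i)
      rwa [Nat.add_sub_cancel' (Finset.mem_range.1 hi).le] at this
    refine h2.trans ?_
    rw [← Finset.mul_sum, hD, div_eq_mul_inv]
    refine mul_le_mul_of_nonneg_left ?_ hC0
    -- Giving up one factor `ρ` turns the sum into a reflected partial geometric series.
    have h3 : ∑ i ∈ Finset.range n, ρ ^ (n - i) ≤ ∑ i ∈ Finset.range n, ρ ^ (n - 1 - i) :=
      Finset.sum_le_sum fun i _ => pow_le_pow_of_le_one hρ0 hρ1.le (by omega)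
    refine h3.trans ?_
    rw [Finset.sum_range_reflect (fun i => ρ ^ i) n, ← tsum_geometric_of_lt_one hρ0 hρ1]
    exact (summable_geometric_of_lt_one hρ0 hρ1).sum_le_tsum _ fun i _ => pow_nonneg hρ0 i
  -- The second moment grows at most linearly: each step adds twice a cross term, at most `D`, and a
  -- square, at most `C`.
  have hsq : ∀ n : ℕ, ∫ ω, s n ω * s n ω ∂μ ≤ n * (2 * D + C) := by
    intro n
    induction n with
    | zero => simp [hs]
    | succ n ih =>
      have h1 : ∀ ω, s (n + 1) ω * s (n + 1) ω
          = s n ω * s n ω + 2 * (s n ω * X n ω) + X n ω * X n ω := fun ω => by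
        simp only [hs, Finset.sum_range_succ]
        ring
      have i1 := hintmul (hsm n) (hsm n) (hsb n) (hsb n)
      have i2 := (hintmul (hsm n) (hX n) (hsb n) (hB n)).const_mul 2
      have i3 := hintmul (hX n) (hX n) (hB n) (hB n)
      simp_rw [h1]
      have h4 := integral_add (i1.add i2) i3
      have h5 := integral_add i1 i2
      simp only [Pi.add_apply] at h4 h5
      rw [h4, h5, integral_const_mul]
      have h2 := hcross n
      have h3 := hC n 0
      simp only [add_zero, pow_zero, mul_one] at h3
      push_cast
      linarith
  -- Along squares the normalised second moments are at most `(2 * D + C) / k ^ 2`, which is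
  -- summable.
  have hae : ∀ᵐ ω ∂μ, Tendsto (fun k : ℕ => s (k ^ 2) ω * s (k ^ 2) ω * ((k : ℝ) ^ 4)⁻¹)
      atTop (𝓝 0) := by
    have i1 := fun k : ℕ => (hintmul (hsm (k ^ 2)) (hsm (k ^ 2)) (hsb _) (hsb _)).mul_const
      ((k : ℝ) ^ 4)⁻¹
    refine ae_tendsto_zero_of_summable_integral (fun k ω => ?_) i1 ?_
    · exact mul_nonneg (mul_self_nonneg _) (by positivity)
    · refine Summable.of_nonneg_of_le (fun k => ?_) (fun k => ?_)
        ((Real.summable_nat_pow_inv.2 one_lt_two).mul_left (2 * D + C))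
      · exact integral_nonneg fun ω => mul_nonneg (mul_self_nonneg _) (by positivity)
      · rw [integral_mul_const]
        rcases Nat.eq_zero_or_pos k with rfl | hk
        · simp
        · have hk' : (0 : ℝ) < k := by exact_mod_cast hk
          calc _ ≤ ((k ^ 2 : ℕ) : ℝ) * (2 * D + C) * ((k : ℝ) ^ 4)⁻¹ := by
                gcongr
                exact hsq _
            _ = _ := by
                push_cast
                field_simp
  filter_upwards [hae] with ω hω
  refine tendsto_div_of_tendsto_sq (s := fun n => s n ω) (B := B) (fun i => ?_) ?_
  · simpa [hs, Finset.sum_range_succ] using hB i ω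
  · have h1 : Tendsto (fun k : ℕ => (s (k ^ 2) ω / (k : ℝ) ^ 2) ^ 2) atTop (𝓝 0) := by
      refine hω.congr fun k => ?_
      rw [div_pow, ← pow_mul, div_eq_mul_inv, pow_two (s _ ω)]
    have h2 := (Real.continuous_sqrt.tendsto 0).comp h1
    rw [Real.sqrt_zero] at h2
    rw [tendsto_zero_iff_abs_tendsto_zero]
    refine h2.congr fun k => ?_
    simp [Real.sqrt_sq_eq_abs]

end StrongLaw

/-! ### Geometric mixing of stochastic matrices. -/

section Mixing

variable {S : Type*} [Fintype S] [DecidableEq S]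

/-- The powers of `K`, applied to `f`, converge geometrically fast to the constant function `p`. -/
def MixesTo (K : Matrix S S ℝ) (f : S → ℝ) (p : ℝ) : Prop :=
  ∃ C ρ : ℝ, 0 < ρ ∧ ρ < 1 ∧ ∀ k s, |(K ^ k).mulVec f s - p| ≤ C * ρ ^ k

theorem mulVec_const_of_mem_rowStochastic {K : Matrix S S ℝ} (hK : K ∈ Matrix.rowStochastic ℝ S)
    (p : ℝ) : K.mulVec (fun _ => p) = fun _ => p := by
  ext s
  simp [Matrix.mulVec, dotProduct, ← Finset.sum_mul,
    (Matrix.mem_rowStochastic_iff_sum.1 hK).2 s]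

theorem abs_mulVec_sub_le_of_mem_rowStochastic {K : Matrix S S ℝ}
    (hK : K ∈ Matrix.rowStochastic ℝ S) {f : S → ℝ} {p d : ℝ} (hf : ∀ s, |f s - p| ≤ d) (s : S) :
    |K.mulVec f s - p| ≤ d := by
  obtain ⟨h0, h1⟩ := Matrix.mem_rowStochastic_iff_sum.1 hK
  have h : K.mulVec f s - p = ∑ y, K s y * (f y - p) := by
    simp [Matrix.mulVec, dotProduct, mul_sub, ← Finset.sum_mul, h1]
  rw [h]
  refine (Finset.abs_sum_le_sum_abs _ _).trans ?_
  calc _ ≤ ∑ y, K s y * d := Finset.sum_le_sum fun y _ => by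
        rw [abs_mul, abs_of_nonneg (h0 s y)]
        exact mul_le_mul_of_nonneg_left (hf y) (h0 s y)
    _ = d := by rw [← Finset.sum_mul, h1, one_mul]

/-- Under Doeblin's minorization `ν ≤ K s`, the matrix `K` contracts oscillations. -/
theorem mulVec_sub_le_of_minorization [Nonempty S] {K : Matrix S S ℝ}
    (hK : K ∈ Matrix.rowStochastic ℝ S) {ν : S → ℝ} (hν : ∀ s y, ν y ≤ K s y)
    {f : S → ℝ} {d : ℝ} (hf : ∀ s t, f s - f t ≤ d) (s t : S) :
    K.mulVec f s - K.mulVec f t ≤ (1 - ∑ y, ν y) * d := by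
  obtain ⟨_, h1⟩ := Matrix.mem_rowStochastic_iff_sum.1 hK
  obtain ⟨x, hx⟩ := Finite.exists_max f
  obtain ⟨z, hz⟩ := Finite.exists_min f
  -- The residual rows `K s - ν` are nonnegative with the same mass `1 - ∑ ν`; the common part `ν`
  -- cancels when two rows are compared.
  have hmass : ∀ s, ∑ y, (K s y - ν y) = 1 - ∑ y, ν y := fun s => by
    rw [Finset.sum_sub_distrib, h1]
  have hsplit : ∀ s, K.mulVec f s = ∑ y, (K s y - ν y) * f y + ∑ y, ν y * f y := fun s => by
    simp [Matrix.mulVec, dotProduct, sub_mul]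
  have hup : ∑ y, (K s y - ν y) * f y ≤ (1 - ∑ y, ν y) * f x := by
    rw [← hmass s, Finset.sum_mul]
    exact Finset.sum_le_sum fun y _ => mul_le_mul_of_nonneg_left (hx y) (sub_nonneg.2 (hν s y))
  have hlow : (1 - ∑ y, ν y) * f z ≤ ∑ y, (K t y - ν y) * f y := by
    rw [← hmass t, Finset.sum_mul]
    exact Finset.sum_le_sum fun y _ => mul_le_mul_of_nonneg_left (hz y) (sub_nonneg.2 (hν t y))
  have hpos : 0 ≤ 1 - ∑ y, ν y := by
    rw [← hmass s]
    exact Finset.sum_nonneg fun y _ => sub_nonneg.2 (hν s y)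
  have := mul_le_mul_of_nonneg_left (hf x z) hpos
  rw [hsplit s, hsplit t]
  linarith

/-- The oscillation of `K ^ k f` shrinks by `ρ = 1 - ∑ ν` at each step, so its values at one state
form a Cauchy sequence and all other states follow. The bound `hν1` makes `ρ` positive, so that
later estimates may divide by its powers. -/
theorem exists_mixesTo_of_minorization [Nonempty S] {K : Matrix S S ℝ}
    (hK : K ∈ Matrix.rowStochastic ℝ S) {ν : S → ℝ} (hν : ∀ s y, ν y ≤ K s y)
    (hν0 : 0 < ∑ y, ν y) (hν1 : ∑ y, ν y < 1) (f : S → ℝ) : ∃ p, MixesTo K f p := by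
  obtain ⟨x, hx⟩ := Finite.exists_max f
  obtain ⟨z, hz⟩ := Finite.exists_min f
  set ρ := 1 - ∑ y, ν y with hρ
  set d := f x - f z
  have hρ0 : 0 < ρ := by linarith
  have hρ1 : ρ < 1 := by linarith
  have hosc : ∀ (k : ℕ) (s t : S), (K ^ k).mulVec f s - (K ^ k).mulVec f t ≤ d * ρ ^ k := by
    intro k
    induction k with
    | zero =>
      intro s t
      simp only [pow_zero, Matrix.one_mulVec, mul_one]
      have := hx s
      have := hz t
      simp only [d]
      linarith
    | succ k ih =>
      intro s t
      rw [pow_succ', ← Matrix.mulVec_mulVec, pow_succ, ← mul_assoc, mul_comm _ ρ]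
      exact mulVec_sub_le_of_minorization hK hν ih s t
  have hosc' : ∀ (k : ℕ) (s t : S), |(K ^ k).mulVec f s - (K ^ k).mulVec f t| ≤ d * ρ ^ k :=
    fun k s t => abs_sub_le_iff.2 ⟨hosc k s t, hosc k t s⟩
  let o : S := Classical.arbitrary S
  -- The next value at `o` is an average of the current values, all within the oscillation of the
  -- one at `o`.
  have hstep : ∀ k, dist ((K ^ k).mulVec f o) ((K ^ (k + 1)).mulVec f o) ≤ d * ρ ^ k := by
    intro k
    rw [dist_comm, Real.dist_eq, pow_succ', ← Matrix.mulVec_mulVec]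
    exact abs_mulVec_sub_le_of_mem_rowStochastic hK (fun s => hosc' k s o) o
  obtain ⟨p, hp⟩ := cauchySeq_tendsto_of_complete (cauchySeq_of_le_geometric ρ d hρ1 hstep)
  refine ⟨p, d + d / (1 - ρ), ρ, hρ0, hρ1, fun k s => ?_⟩
  have h1 := dist_le_of_le_geometric_of_tendsto ρ d hρ1 hstep hp k
  rw [Real.dist_eq] at h1
  have h2 := abs_add_le ((K ^ k).mulVec f s - (K ^ k).mulVec f o) ((K ^ k).mulVec f o - p)
  rw [sub_add_sub_cancel] at h2
  have h3 := hosc' k s o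
  have h4 : (d + d / (1 - ρ)) * ρ ^ k = d * ρ ^ k + d * ρ ^ k / (1 - ρ) := by ring
  linarith

theorem mixesTo_const {K : Matrix S S ℝ} (hK : K ∈ Matrix.rowStochastic ℝ S) (p : ℝ) :
    MixesTo K (fun _ => p) p := by
  refine ⟨0, 1 / 2, by norm_num, by norm_num, fun k s => ?_⟩
  rw [mulVec_const_of_mem_rowStochastic (pow_mem hK k)]
  simp

/-- Powers intertwine, `(P * K * Q) ^ k * P = P * K ^ k`, and averaging by the stochastic matrix `P`
keeps values within the same distance of `p`. This is why both POMDPs share their limits. -/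
theorem MixesTo.conj {K P Q : Matrix S S ℝ} {f : S → ℝ} {p : ℝ}
    (hP : P ∈ Matrix.rowStochastic ℝ S) (hQP : Q * P = 1) (h : MixesTo K f p) :
    MixesTo (P * K * Q) (P.mulVec f) p := by
  obtain ⟨C, ρ, h0, h1, hC⟩ := h
  refine ⟨C, ρ, h0, h1, fun k s => ?_⟩
  have hpow : ∀ k, (P * K * Q) ^ k * P = P * K ^ k := by
    intro k
    induction k with
    | zero => simp
    | succ k ih =>
      have h : P * K * Q * P = P * K := by rw [mul_assoc, hQP, mul_one]
      rw [pow_succ, mul_assoc, h, ← mul_assoc, ih, mul_assoc, ← pow_succ]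
  rw [Matrix.mulVec_mulVec, hpow, ← Matrix.mulVec_mulVec]
  exact abs_mulVec_sub_le_of_mem_rowStochastic hP (hC k) s

end Mixing

/-! ### Finite-valued variables and window weights. -/

theorem integral_comp_eq_sum {Ω E : Type*} [MeasurableSpace Ω] {μ : Measure Ω} [IsFiniteMeasure μ]
    [Fintype E] {Y : Ω → E} (hY : ∀ e, MeasurableSet {ω | Y ω = e}) (G : E → ℝ) :
    ∫ ω, G (Y ω) ∂μ = ∑ e, μ.real {ω | Y ω = e} * G e := by
  let _ : MeasurableSpace E := ⊤
  have hm : Measurable Y := measurable_to_countable' hY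
  have h1 : ∫ ω, G (Y ω) ∂μ = ∫ e, G e ∂(μ.map Y) :=
    (integral_map hm.aemeasurable (Measurable.of_discrete (f := G)).aestronglyMeasurable).symm
  rw [h1, integral_fintype (Integrable.of_finite)]
  refine Finset.sum_congr rfl fun e _ => ?_
  rw [map_measureReal_apply hm (measurableSet_singleton e), smul_eq_mul]
  rfl

theorem measurable_comp_of_finite {Ω E : Type*} [MeasurableSpace Ω]
    [Finite E] {Y : Ω → E} (hY : ∀ e, MeasurableSet {ω | Y ω = e}) (G : E → ℝ) :
    Measurable fun ω => G (Y ω) := by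
  let _ : MeasurableSpace E := ⊤
  exact (Measurable.of_discrete (f := G)).comp (measurable_to_countable' hY)

/-- The product of the weights `l` over the window of the sequence `c` that starts at `i`. -/
def windowWeight {C : Type*} (c : ℕ → C) : ℕ → List (C → ℝ) → ℝ
  | _, [] => 1
  | i, f :: l => f (c i) * windowWeight c (i + 1) l

theorem windowWeight_mem_Icc {C : Type*} (c : ℕ → C) {l : List (C → ℝ)}
    (hl : ∀ f ∈ l, ∀ x, f x ∈ Set.Icc (0 : ℝ) 1) (i : ℕ) :
    windowWeight c i l ∈ Set.Icc (0 : ℝ) 1 := by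
  induction l generalizing i with
  | nil => simp [windowWeight]
  | cons f l ih =>
    have h1 := hl f (by simp) (c i)
    have h2 := ih (fun g hg => hl g (by simp [hg])) (i + 1)
    exact ⟨mul_nonneg h1.1 h2.1, mul_le_one₀ h1.2 h2.1 h2.2⟩

theorem windowWeight_congr {C : Type*} {c c' : ℕ → C} (l : List (C → ℝ)) {i : ℕ}
    (h : ∀ t < i + l.length, c t = c' t) : windowWeight c i l = windowWeight c' i l := by
  induction l generalizing i with
  | nil => rfl
  | cons f l ih =>
    simp only [List.length_cons] at h
    rw [windowWeight, windowWeight, h i (by omega), ih fun t ht => h t (by omega)]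

open Classical in
-- With indicators as weights, sums of window weights become the counts in the empirical Hankel
-- matrix.
theorem windowWeight_indicator {C β : Type*} (c : ℕ → C) (φ : C → β) (w : List β) (i : ℕ) :
    windowWeight c i (w.map fun b => Set.indicator {x | φ x = b} 1) =
      if (List.range w.length).map (fun k => φ (c (i + k))) = w then 1 else 0 := by
  induction w generalizing i with
  | nil => simp [windowWeight]
  | cons b w ih =>
    rw [List.map_cons, windowWeight, ih, List.length_cons, List.range_succ_eq_map, List.map_cons,
      List.map_map]
    simp only [Function.comp_def, Nat.succ_eq_add_one, add_zero, List.cons.injEq,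
      Set.indicator_apply, Set.mem_ofPred_eq, Pi.one_apply, ite_and, mul_ite, mul_one, mul_zero]
    simp only [add_assoc, add_comm 1]
    split_ifs <;> rfl

theorem empiricalHankel_eq_div {A O : Type*} (act : ℕ → A) (obs : ℕ → O) (n : ℕ)
    (hist test : List (A × O)) :
    empiricalHankel act obs n hist test =
      (∑ i ∈ Finset.range (n - (hist ++ test).length), windowWeight (fun t => (act t, obs t)) i
        ((hist ++ test).map fun b => Set.indicator {x | x = b} 1)) /
      (∑ i ∈ Finset.range (n - (hist ++ test).length), windowWeight (fun t => (act t, obs t)) i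
        (((hist ++ test).map Prod.fst).map fun b => Set.indicator {x | x.1 = b} 1)) := by
  classical
  have h1 := windowWeight_indicator (fun t => (act t, obs t)) id (hist ++ test)
  have h2 := windowWeight_indicator (fun t => (act t, obs t)) Prod.fst
    ((hist ++ test).map Prod.fst)
  simp only [id, List.length_map] at h1 h2
  simp only [h1, h2, empiricalHankel]
  rw [← Finset.sum_boole, ← Finset.sum_boole]
  congr!

/-! ### Histories, and the one-step matrices of uniform exploration. -/

namespace POMDP

section History

variable {S A O Ω : Type*} {st : ℕ → Ω → S} {act : ℕ → Ω → A} {obs : ℕ → Ω → O}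

/-- The past up to the state at time `m`. -/
def history (st : ℕ → Ω → S) (act : ℕ → Ω → A) (obs : ℕ → Ω → O) (m : ℕ) (ω : Ω) :
    (Fin m → S × A × O) × S :=
  (fun t => (st t ω, act t ω, obs t ω), st m ω)

theorem history_eq_iff {m : ℕ} {ω : Ω} {h : (Fin m → S × A × O) × S} :
    history st act obs m ω = h ↔
      (∀ t : Fin m, st t ω = (h.1 t).1 ∧ act t ω = (h.1 t).2.1 ∧ obs t ω = (h.1 t).2.2) ∧
        st m ω = h.2 := by
  simp [history, Prod.ext_iff, funext_iff]

theorem history_eq_history_iff {m : ℕ} {ω ω' : Ω} :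
    history st act obs m ω = history st act obs m ω' ↔
      (∀ t < m, st t ω = st t ω' ∧ act t ω = act t ω' ∧ obs t ω = obs t ω') ∧
        st m ω = st m ω' := by
  rw [history_eq_iff]
  simp [history, Fin.forall_iff]

/-- Factoring through `history` plays the role of adaptedness to a filtration. For `m < n`, the last
state of the shorter history is a coordinate of the longer one. -/
theorem factorsThrough_history_mono {F : Ω → ℝ} {m n : ℕ} (hmn : m ≤ n)
    (hF : F.FactorsThrough (history st act obs m)) :
    F.FactorsThrough (history st act obs n) := by
  intro ω ω' h
  refine hF (history_eq_history_iff.2 ?_)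
  obtain ⟨h1, h2⟩ := history_eq_history_iff.1 h
  refine ⟨fun t ht => h1 t (ht.trans_le hmn), ?_⟩
  rcases hmn.eq_or_lt with rfl | hlt
  · exact h2
  · exact (h1 m hlt).1

theorem factorsThrough_history_windowWeight (l : List (A × O → ℝ)) (i : ℕ) :
    (fun ω => windowWeight (fun t => (act t ω, obs t ω)) i l).FactorsThrough
      (history st act obs (i + l.length)) := fun ω ω' h =>
  windowWeight_congr l fun t ht => by
    obtain ⟨h1, -⟩ := history_eq_history_iff.1 h
    rw [(h1 t ht).2.1, (h1 t ht).2.2]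

theorem factorsThrough_history_state (g : S → ℝ) (m : ℕ) :
    (fun ω => g (st m ω)).FactorsThrough (history st act obs m) := fun ω ω' h => by
  simp only [(history_eq_history_iff.1 h).2]

theorem factorsThrough_history_mul {F G : Ω → ℝ} {m : ℕ}
    (hF : F.FactorsThrough (history st act obs m))
    (hG : G.FactorsThrough (history st act obs m)) :
    (fun ω => F ω * G ω).FactorsThrough (history st act obs m) := fun ω ω' h => by
  simp only [hF h, hG h]

theorem exists_eq_comp_history {F : Ω → ℝ} {m : ℕ}
    (hF : F.FactorsThrough (history st act obs m)) :
    ∃ G : (Fin m → S × A × O) × S → ℝ, F = fun ω => G (history st act obs m ω) :=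
  (Function.factorsThrough_iff F).1 hF

end History

variable {S A O : Type*} [Fintype S] [DecidableEq S] [Fintype O] [Fintype A]

/-- The substochastic matrix of one step under uniform exploration, weighted by a function of the
action and the observation. -/
noncomputable def weightMatrix (M : POMDP S A O) (f : A × O → ℝ) : Matrix S S ℝ :=
  ∑ c : A × O, (f c / Fintype.card A) • (M.Z c.1 c.2 * M.T c.1)

/-- The expected weight of a window, as a function of the state at its start. -/
noncomputable def windowValue (M : POMDP S A O) : List (A × O → ℝ) → S → ℝ
  | [] => fun _ => 1
  | f :: l => (M.weightMatrix f).mulVec (windowValue M l)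

theorem weightMatrix_apply (M : POMDP S A O) (f : A × O → ℝ) (x y : S) :
    M.weightMatrix f x y = ∑ a, ∑ o,
      f (a, o) * (1 / Fintype.card A * M.Z a o x x * M.T a x y) := by
  rw [weightMatrix, Matrix.sum_apply, Fintype.sum_prod_type]
  refine Finset.sum_congr rfl fun a _ => Finset.sum_congr rfl fun o _ => ?_
  rw [Matrix.smul_apply, Matrix.mul_apply, Finset.sum_eq_single x, smul_eq_mul]
  · ring
  · intro s _ hs
    rw [M.Z_diag a o hs.symm, zero_mul]
  · simp

theorem weightMatrix_fst_apply (M : POMDP S A O) (g : A → ℝ) (x y : S) :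
    M.weightMatrix (fun c => g c.1) x y = ∑ a, g a / Fintype.card A * M.T a x y := by
  rw [weightMatrix_apply]
  refine Finset.sum_congr rfl fun a _ => ?_
  have h := M.Z_sum a x
  calc _ = g a / Fintype.card A * M.T a x y * ∑ o, M.Z a o x x := by
        rw [Finset.mul_sum]
        exact Finset.sum_congr rfl fun o _ => by ring
    _ = _ := by rw [h, mul_one]

theorem weightMatrix_one_mem_rowStochastic [Nonempty A] (M : POMDP S A O) :
    M.weightMatrix 1 ∈ Matrix.rowStochastic ℝ S := by
  have hA : (Fintype.card A : ℝ) ≠ 0 := by simp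
  have h := M.weightMatrix_fst_apply 1
  simp only [Pi.one_apply] at h
  change ∀ x y, M.weightMatrix 1 x y = _ at h
  rw [Matrix.mem_rowStochastic_iff_sum]
  refine ⟨fun i j => ?_, fun i => ?_⟩
  · rw [h]
    exact Finset.sum_nonneg fun a _ => mul_nonneg (by positivity)
      ((Matrix.mem_rowStochastic_iff_sum.1 (M.T_mem a)).1 i j)
  · simp_rw [h]
    rw [Finset.sum_comm]
    simp_rw [← Finset.mul_sum, (Matrix.mem_rowStochastic_iff_sum.1 (M.T_mem _)).2 i]
    simp [hA]

/-- If some action forgets the current state, uniform exploration is geometrically mixing. -/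
theorem exists_mixesTo_of_reset [Nonempty S] [Nontrivial A] (M : POMDP S A O) {r : A}
    (hr : ∀ i j, M.T r i = M.T r j) (f : S → ℝ) : ∃ p, MixesTo (M.weightMatrix 1) f p := by
  let o : S := Classical.arbitrary S
  have hA : (1 : ℝ) < Fintype.card A := by exact_mod_cast Fintype.one_lt_card
  have hA' : (0 : ℝ) < Fintype.card A := one_pos.trans hA
  have h := M.weightMatrix_fst_apply 1
  simp only [Pi.one_apply] at h
  change ∀ x y, M.weightMatrix 1 x y = _ at h
  -- The minorizing measure is the common row of `r`, weighted by the chance of choosing `r`. Its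
  -- mass `1 / |A|` is below one because there are at least two actions.
  have hsum : ∑ y, 1 / (Fintype.card A : ℝ) * M.T r o y = 1 / Fintype.card A := by
    rw [← Finset.mul_sum, (Matrix.mem_rowStochastic_iff_sum.1 (M.T_mem r)).2 o, mul_one]
  refine exists_mixesTo_of_minorization M.weightMatrix_one_mem_rowStochastic
    (ν := fun y => 1 / Fintype.card A * M.T r o y) (fun s y => ?_) ?_ ?_ f
  · rw [h, hr o s]
    exact Finset.single_le_sum (f := fun a => 1 / (Fintype.card A : ℝ) * M.T a s y)
      (fun a _ => mul_nonneg (by positivity)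
        ((Matrix.mem_rowStochastic_iff_sum.1 (M.T_mem a)).1 s y)) (Finset.mem_univ r)
  · rw [hsum]
    positivity
  · rw [hsum, div_lt_one hA']
    exact hA

/-- Observation weights and transition rows sum to one, so each prescribed action contributes `1 /
|A|` whatever the state. The denominators' window values are therefore constant and mix trivially.
-/
theorem windowValue_actions (M : POMDP S A O) (u : List A) :
    M.windowValue (u.map fun b => Set.indicator {x | x.1 = b} 1) =
      fun _ => (1 / (Fintype.card A : ℝ)) ^ u.length := by
  classical
  induction u with
  | nil => simp [windowValue]
  | cons b u ih =>
    rw [List.map_cons, windowValue, ih]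
    have h1 : (Set.indicator {x : A × O | x.1 = b} 1 : A × O → ℝ) =
        fun c => if c.1 = b then 1 else 0 := by
      ext c
      simp [Set.indicator_apply]
    ext s
    rw [h1, Matrix.mulVec, dotProduct]
    simp_rw [M.weightMatrix_fst_apply fun a => if a = b then 1 else 0]
    simp only [ite_div, zero_div, ite_mul, zero_mul, Finset.sum_ite_eq', Finset.mem_univ, if_true]
    rw [← Finset.sum_mul, ← Finset.mul_sum,
      (Matrix.mem_rowStochastic_iff_sum.1 (M.T_mem b)).2 s, mul_one, List.length_cons, pow_succ']

/-! ### The Markov property and almost sure convergence along a run. -/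

section Run

variable {M : POMDP S A O} {Ω : Type*} [MeasurableSpace Ω] {μ : Measure Ω}
  {st : ℕ → Ω → S} {act : ℕ → Ω → A} {obs : ℕ → Ω → O}

namespace IsUniformRun

theorem measurableSet_history (hrun : M.IsUniformRun μ st act obs) (m : ℕ)
    (h : (Fin m → S × A × O) × S) : MeasurableSet {ω | history st act obs m ω = h} := by
  have h1 : {ω | history st act obs m ω = h} =
      (⋂ t : Fin m, {ω | st t ω = (h.1 t).1} ∩ ({ω | act t ω = (h.1 t).2.1} ∩
        {ω | obs t ω = (h.1 t).2.2})) ∩ {ω | st m ω = h.2} := by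
    ext ω
    simp [history_eq_iff]
  rw [h1]
  exact (MeasurableSet.iInter fun t => (hrun.measurable_st _ _).inter
    ((hrun.measurable_act _ _).inter (hrun.measurable_obs _ _))).inter (hrun.measurable_st _ _)

theorem measurable_of_factorsThrough (hrun : M.IsUniformRun μ st act obs) {F : Ω → ℝ} {m : ℕ}
    (hF : F.FactorsThrough (history st act obs m)) : Measurable F := by
  obtain ⟨G, rfl⟩ := exists_eq_comp_history hF
  exact measurable_comp_of_finite (hrun.measurableSet_history m) G

theorem integrable_of_factorsThrough [IsFiniteMeasure μ] (hrun : M.IsUniformRun μ st act obs)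
    {F : Ω → ℝ} {m : ℕ} (hF : F.FactorsThrough (history st act obs m)) : Integrable F μ := by
  have hm := hrun.measurable_of_factorsThrough hF
  obtain ⟨G, rfl⟩ := exists_eq_comp_history hF
  refine Integrable.of_bound hm.aestronglyMeasurable (∑ h, |G h|) (ae_of_all _ fun ω => ?_)
  exact Finset.single_le_sum (f := fun h => |G h|) (fun h _ => abs_nonneg _) (Finset.mem_univ _)

theorem measureReal_step (hrun : M.IsUniformRun μ st act obs) (m : ℕ)
    (h : (Fin m → S × A × O) × S) (a : A) (o : O) (y : S) :
    μ.real {ω | (history st act obs m ω, act m ω, obs m ω, st (m + 1) ω) = (h, a, o, y)} =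
      μ.real {ω | history st act obs m ω = h} *
        (1 / Fintype.card A * M.Z a o h.2 h.2 * M.T a h.2 y) := by
  -- The law is stated for infinite sequences, so the finite history is extended; one choice serves
  -- both times `m` and `m + 1`, and the two products differ by the last factor.
  let x : ℕ → S := fun t => if ht : t < m then (h.1 ⟨t, ht⟩).1 else if t = m then h.2 else y
  let u : ℕ → A := fun t => if ht : t < m then (h.1 ⟨t, ht⟩).2.1 else a
  let z : ℕ → O := fun t => if ht : t < m then (h.1 ⟨t, ht⟩).2.2 else o
  have e1 : {ω | history st act obs m ω = h} =
      {ω | (∀ t < m, st t ω = x t ∧ act t ω = u t ∧ obs t ω = z t) ∧ st m ω = x m} := by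
    ext ω
    simp only [Set.mem_ofPred_eq, history_eq_iff, Fin.forall_iff]
    refine and_congr (forall₂_congr fun t ht => ?_) ?_
    · simp [x, u, z, ht]
    · simp [x]
  have e2 : {ω | (history st act obs m ω, act m ω, obs m ω, st (m + 1) ω) = (h, a, o, y)} =
      {ω | (∀ t < m + 1, st t ω = x t ∧ act t ω = u t ∧ obs t ω = z t) ∧
        st (m + 1) ω = x (m + 1)} := by
    ext ω
    have := Set.ext_iff.1 e1 ω
    simp only [Set.mem_ofPred_eq] at this
    have hx : x (m + 1) = y := by simp [x]
    have hu : u m = a := by simp [u]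
    have hz : z m = o := by simp [z]
    simp only [Set.mem_ofPred_eq, Prod.mk.injEq, this, Nat.lt_succ_iff_lt_or_eq, or_imp,
      forall_and, forall_eq, hx, hu, hz]
    tauto
  rw [e1, e2, hrun.law, hrun.law, Finset.prod_range_succ, ← mul_assoc]
  simp [x, u, z]

/-- The Markov property: the conditional expectation of a step given the past. -/
theorem integral_step [IsFiniteMeasure μ] (hrun : M.IsUniformRun μ st act obs) {F : Ω → ℝ} {m : ℕ}
    (hF : F.FactorsThrough (history st act obs m)) (f : A × O → ℝ) (g : S → ℝ) :
    ∫ ω, F ω * (f (act m ω, obs m ω) * g (st (m + 1) ω)) ∂μ =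
      ∫ ω, F ω * (M.weightMatrix f).mulVec g (st m ω) ∂μ := by
  obtain ⟨G, rfl⟩ := exists_eq_comp_history hF
  have hY : ∀ e : ((Fin m → S × A × O) × S) × A × O × S, MeasurableSet
      {ω | (history st act obs m ω, act m ω, obs m ω, st (m + 1) ω) = e} := by
    rintro ⟨h, a, o, y⟩
    simp only [Prod.mk.injEq]
    exact (hrun.measurableSet_history m h).inter ((hrun.measurable_act m a).inter
      ((hrun.measurable_obs m o).inter (hrun.measurable_st _ y)))
  have h1 := integral_comp_eq_sum (μ := μ) hY
    fun e => G e.1 * (f (e.2.1, e.2.2.1) * g e.2.2.2)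
  have h2 := integral_comp_eq_sum (μ := μ) (hrun.measurableSet_history m)
    fun h => G h * (M.weightMatrix f).mulVec g h.2
  simp only at h1 h2
  refine h1.trans (Eq.trans ?_ h2.symm)
  have hmul : ∀ x, (M.weightMatrix f).mulVec g x = ∑ a, ∑ o, ∑ y,
      f (a, o) * (1 / Fintype.card A * M.Z a o x x * M.T a x y) * g y := fun x => by
    simp_rw [Matrix.mulVec, dotProduct, weightMatrix_apply, Finset.sum_mul]
    rw [Finset.sum_comm]
    exact Finset.sum_congr rfl fun a _ => Finset.sum_comm
  simp_rw [Fintype.sum_prod_type (α₁ := (Fin m → S × A × O) × S), Fintype.sum_prod_type (α₁ := A),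
    Fintype.sum_prod_type (α₁ := O), hrun.measureReal_step, hmul, Finset.mul_sum]
  refine Finset.sum_congr rfl fun h _ => Finset.sum_congr rfl fun a _ =>
    Finset.sum_congr rfl fun o _ => Finset.sum_congr rfl fun y _ => ?_
  ring

/-- The first letter's weight is absorbed into `F`, which is then determined by the history one step
later; after the induction, the Markov property moves this step into the matrix. -/
theorem integral_windowWeight [IsFiniteMeasure μ] (hrun : M.IsUniformRun μ st act obs)
    (l : List (A × O → ℝ)) {F : Ω → ℝ} {i : ℕ} (hF : F.FactorsThrough (history st act obs i)) :
    ∫ ω, F ω * windowWeight (fun t => (act t ω, obs t ω)) i l ∂μ =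
      ∫ ω, F ω * M.windowValue l (st i ω) ∂μ := by
  induction l generalizing F i with
  | nil => rfl
  | cons f l ih =>
    have hf : (fun ω => F ω * f (act i ω, obs i ω)).FactorsThrough
        (history st act obs (i + 1)) := by
      refine factorsThrough_history_mul (factorsThrough_history_mono i.le_succ hF) ?_
      intro ω ω' h
      obtain ⟨h1, -⟩ := history_eq_history_iff.1 h
      simp only [(h1 i i.lt_succ_self).2.1, (h1 i i.lt_succ_self).2.2]
    simp only [windowWeight, windowValue]
    rw [← hrun.integral_step hF]
    simp only [← mul_assoc]
    exact ih hf

theorem integral_state_add [IsFiniteMeasure μ] [Nonempty A] (hrun : M.IsUniformRun μ st act obs)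
    (k : ℕ) (g : S → ℝ) {F : Ω → ℝ} {i : ℕ} (hF : F.FactorsThrough (history st act obs i)) :
    ∫ ω, F ω * g (st (i + k) ω) ∂μ =
      ∫ ω, F ω * (M.weightMatrix 1 ^ k).mulVec g (st i ω) ∂μ := by
  induction k generalizing g with
  | zero => simp
  | succ k ih =>
    have h := hrun.integral_step (factorsThrough_history_mono (i.le_add_right k) hF) 1 g
    simp only [Pi.one_apply, one_mul] at h
    rw [← add_assoc, h, ih, Matrix.mulVec_mulVec, ← pow_succ]

/-- Window averages along a mixing run converge almost surely. -/
theorem ae_tendsto_average_windowWeight [IsProbabilityMeasure μ] [Nonempty A]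
    (hrun : M.IsUniformRun μ st act obs) {l : List (A × O → ℝ)}
    (hl : ∀ f ∈ l, ∀ x, f x ∈ Set.Icc (0 : ℝ) 1) {p : ℝ}
    (hp : MixesTo (M.weightMatrix 1) (M.windowValue l) p) :
    ∀ᵐ ω ∂μ, Tendsto (fun n : ℕ => (∑ i ∈ Finset.range n,
      windowWeight (fun t => (act t ω, obs t ω)) i l) / n) atTop (𝓝 p) := by
  obtain ⟨C, ρ, hρ0, hρ1, hC⟩ := hp
  set X : ℕ → Ω → ℝ := fun i ω => windowWeight (fun t => (act t ω, obs t ω)) i l - p with hX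
  have hXF : ∀ i, (X i).FactorsThrough (history st act obs (i + l.length)) := fun i ω ω' h => by
    have h1 := factorsThrough_history_windowWeight l i h
    simp only at h1
    simp only [hX, h1]
  have hXB : ∀ i ω, |X i ω| ≤ 1 + |p| := fun i ω => by
    have h1 := windowWeight_mem_Icc (fun t => (act t ω, obs t ω)) hl i
    refine (abs_sub _ _).trans ?_
    rw [abs_of_nonneg h1.1]
    linarith [h1.2]
  set B := 1 + |p| with hB
  have hB0 : 0 ≤ B := by positivity
  -- Overlapping windows, `k < l.length`, are bounded trivially, the factor `(ρ ^ l.length)⁻¹`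
  -- absorbing the loss. For disjoint ones, conditioning on the history at the end of the first
  -- window leaves `k - l.length` steps of mixing.
  have hcorr : ∀ i k, ∫ ω, X i ω * X (i + k) ω ∂μ ≤ B * (|C| + B) * (ρ ^ l.length)⁻¹ * ρ ^ k := by
    intro i k
    have hbound : ∀ {Y : Ω → ℝ} {b : ℝ}, (∀ ω, |Y ω| ≤ b) → ∫ ω, Y ω ∂μ ≤ b := by
      intro Y b hY
      have := norm_integral_le_of_norm_le_const (μ := μ) (f := Y) (C := b) (ae_of_all _ hY)
      simp only [probReal_univ, mul_one, Real.norm_eq_abs] at this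
      exact (le_abs_self _).trans this
    have hρL : 0 < ρ ^ l.length := pow_pos hρ0 _
    rcases lt_or_ge k l.length with hk | hk
    · refine (hbound (b := B * B) fun ω => ?_).trans ?_
      · rw [abs_mul]
        exact mul_le_mul (hXB _ _) (hXB _ _) (abs_nonneg _) hB0
      · have h1 : 1 ≤ (ρ ^ l.length)⁻¹ * ρ ^ k := by
          rw [inv_mul_eq_div, one_le_div hρL]
          exact pow_le_pow_of_le_one hρ0.le hρ1.le hk.le
        have h2 : B * B ≤ B * (|C| + B) := by
          gcongr
          linarith [abs_nonneg C]
        rw [mul_assoc]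
        exact h2.trans (le_mul_of_one_le_right (by positivity) h1)
    · obtain ⟨d, rfl⟩ := Nat.exists_eq_add_of_le hk
      have hF' : (X i).FactorsThrough (history st act obs (i + l.length + d)) :=
        factorsThrough_history_mono (Nat.le_add_right _ _) (hXF i)
      have iw := hrun.integrable_of_factorsThrough (factorsThrough_history_mul
        (factorsThrough_history_mono (Nat.le_add_right _ l.length) hF')
        (factorsThrough_history_windowWeight l (i + l.length + d)))
      have iF := (hrun.integrable_of_factorsThrough (hXF i)).mul_const p
      have iv := hrun.integrable_of_factorsThrough (factorsThrough_history_mul (hXF i)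
        (factorsThrough_history_state
          ((M.weightMatrix 1 ^ d).mulVec (M.windowValue l)) (i + l.length)))
      have h1 : ∫ ω, X i ω * X (i + (l.length + d)) ω ∂μ =
          ∫ ω, X i ω * ((M.weightMatrix 1 ^ d).mulVec (M.windowValue l)
            (st (i + l.length) ω) - p) ∂μ := by
        rw [← add_assoc]
        simp only [mul_sub]
        rw [integral_sub iv iF, ← hrun.integral_state_add d _ (hXF i),
          ← hrun.integral_windowWeight l hF', ← integral_sub iw iF]
        refine integral_congr_ae (ae_of_all _ fun ω => ?_)
        simp only [hX]
        ring
      rw [h1]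
      refine (hbound (b := B * (|C| * ρ ^ d)) fun ω => ?_).trans ?_
      · rw [abs_mul]
        refine mul_le_mul (hXB _ _) ((hC d _).trans ?_) (abs_nonneg _) hB0
        exact mul_le_mul_of_nonneg_right (le_abs_self C) (pow_nonneg hρ0.le d)
      · rw [pow_add, mul_assoc _ _ (_ * _), inv_mul_cancel_left₀ hρL.ne', mul_assoc]
        gcongr
        linarith
  have h := ae_tendsto_average_of_correlation_le
    (fun i => hrun.measurable_of_factorsThrough (hXF i)) hXB hρ0.le hρ1 hcorr
  filter_upwards [h] with ω hω
  have h2 := hω.add_const p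
  rw [zero_add] at h2
  refine h2.congr' ?_
  filter_upwards [eventually_ge_atTop 1] with n hn
  have hn' : (n : ℝ) ≠ 0 := by positivity
  simp only [hX, Finset.sum_sub_distrib, Finset.sum_const, Finset.card_range, nsmul_eq_mul]
  field_simp
  ring

/-- Along a mixing run the empirical Hankel matrix converges almost surely. -/
theorem ae_tendsto_empiricalHankel [IsProbabilityMeasure μ] [Nonempty A]
    (hrun : M.IsUniformRun μ st act obs) {p : List (A × O) → ℝ}
    (hp : ∀ w : List (A × O), MixesTo (M.weightMatrix 1)
      (M.windowValue (w.map fun b => Set.indicator {x | x = b} 1)) (p w)) :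
    ∀ᵐ ω ∂μ, ∀ hist test, Tendsto
      (fun n => empiricalHankel (fun t => act t ω) (fun t => obs t ω) n hist test) atTop
      (𝓝 (p (hist ++ test) / (1 / (Fintype.card A : ℝ)) ^ (hist ++ test).length)) := by
  have hind : ∀ (s : Set (A × O)) x, Set.indicator s (1 : A × O → ℝ) x ∈ Set.Icc (0 : ℝ) 1 :=
    fun s x => ⟨Set.indicator_nonneg (by simp) x, Set.indicator_le_self' (by simp) x⟩
  rw [ae_all_iff]
  intro hist
  rw [ae_all_iff]
  intro test
  have hnum := hrun.ae_tendsto_average_windowWeight (fun f hf => by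
    obtain ⟨b, -, rfl⟩ := List.mem_map.1 hf
    exact hind _) (hp (hist ++ test))
  have hden := hrun.ae_tendsto_average_windowWeight
    (l := ((hist ++ test).map Prod.fst).map fun b => Set.indicator {x | x.1 = b} 1)
    (fun f hf => by
      obtain ⟨b, -, rfl⟩ := List.mem_map.1 hf
      exact hind _)
    (by
      rw [windowValue_actions]
      exact mixesTo_const M.weightMatrix_one_mem_rowStochastic _)
  rw [List.length_map] at hden
  filter_upwards [hnum, hden] with ω h1 h2
  have h3 := (h1.div h2 (by positivity)).comp (tendsto_sub_atTop_nat (hist ++ test).length)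
  refine h3.congr' ?_
  -- Numerator and denominator are averages over the same `n - L` windows; once this number is
  -- nonzero it cancels.
  filter_upwards [eventually_gt_atTop (hist ++ test).length] with n hn
  have hn' : ((n - (hist ++ test).length : ℕ) : ℝ) ≠ 0 := by
    exact_mod_cast (Nat.sub_pos_of_lt hn).ne'
  rw [empiricalHankel_eq_div]
  simp only [Function.comp, Pi.div_apply]
  rw [div_div_div_cancel_right₀ hn']

end IsUniformRun

end Run

end POMDP

/-! ### Comparison of the two Sense-Float-Reset POMDPs. -/

theorem simP_inv_mul_simP : simP⁻¹ * simP = 1 :=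
  Matrix.nonsing_inv_mul _ ((Matrix.isUnit_iff_isUnit_det _).1
    (IsUnit.of_mul_eq_one _ simP_mul_inverse))

theorem transformedSFR_weightMatrix {b b' : Fin 3 → ℝ} (hb : b ∈ stdSimplex ℝ (Fin 3))
    (hb' : b' ∈ stdSimplex ℝ (Fin 3)) (f : SFRAction × Fin 2 → ℝ) :
    (transformedSFR b' hb').weightMatrix f =
      simP * (perturbedSFR b hb).weightMatrix f * simP⁻¹ := by
  simp only [POMDP.weightMatrix, Finset.mul_sum, Finset.sum_mul]
  refine Finset.sum_congr rfl fun c _ => ?_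
  rw [Matrix.mul_smul, Matrix.smul_mul]
  congr 1
  simp only [transformedSFR, perturbedSFR]
  calc _ = simP * sfrZ c.1 c.2 * (simP⁻¹ * simP) * sfrT c.1 * simP⁻¹ := by
        simp only [Matrix.mul_assoc]
    _ = _ := by
        rw [simP_inv_mul_simP, Matrix.mul_one]
        simp only [Matrix.mul_assoc]

/-- The empty window works because `simP` fixes constants; at each further letter an inner `simP⁻¹ *
simP` cancels. -/
theorem transformedSFR_windowValue {b b' : Fin 3 → ℝ} (hb : b ∈ stdSimplex ℝ (Fin 3))
    (hb' : b' ∈ stdSimplex ℝ (Fin 3)) (l : List (SFRAction × Fin 2 → ℝ)) :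
    (transformedSFR b' hb').windowValue l = simP.mulVec ((perturbedSFR b hb).windowValue l) := by
  induction l with
  | nil => exact (mulVec_const_of_mem_rowStochastic simP_mem_rowStochastic 1).symm
  | cons f l ih =>
    rw [POMDP.windowValue, POMDP.windowValue, ih, transformedSFR_weightMatrix hb hb',
      Matrix.mulVec_mulVec, Matrix.mulVec_mulVec, Matrix.mul_assoc, simP_inv_mul_simP,
      Matrix.mul_one]

/-- The action `sense` is of full rank and already separates `0` from the other states, while no
action separates `1` from `2`; so both partitions coincide. -/
theorem obsEquiv_of_Z_eq_sfrZ {M : POMDP (Fin 3) SFRAction (Fin 2)} (hZ : M.Z = sfrZ)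
    (hT : M.T .sense = 1) (i j : Fin 3) :
    (M.ObsEquiv i j ↔ (i = 0 ↔ j = 0)) ∧ (M.FullRankObsEquiv i j ↔ (i = 0 ↔ j = 0)) := by
  have h1 : (i = 0 ↔ j = 0) → M.ObsEquiv i j := by
    intro h a o
    rw [hZ]
    cases a <;> fin_cases o <;> fin_cases i <;> fin_cases j <;> simp_all [sfrZ]
  have h2 : M.FullRankObsEquiv i j → (i = 0 ↔ j = 0) := by
    intro h
    have h3 := h .sense (by rw [hT, Matrix.rank_one]) 1
    rw [hZ] at h3
    fin_cases i <;> fin_cases j <;> simp_all [sfrZ]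
  have h3 : M.ObsEquiv i j → M.FullRankObsEquiv i j := fun h a _ => h a
  tauto

theorem transformedSFR_T_float'_one_one {b' : Fin 3 → ℝ} (hb' : b' ∈ stdSimplex ℝ (Fin 3)) :
    (transformedSFR b' hb').T .float' 1 1 = 9 / 19 := by
  simp only [transformedSFR]
  rw [simP_inv]
  norm_num [simP, sfrT, Matrix.mul_apply, Fin.sum_univ_succ]

theorem sfrT_sense : sfrT .sense = 1 := by
  ext i j
  fin_cases i <;> fin_cases j <;> simp [sfrT]

theorem theorem2 :
    -- the two POMDPs have the same observation matrices and the same (full-rank) observability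
    -- partition `{{0}, {1, 2}}`, but, however the states are relabelled, their transition
    -- probabilities under `float'` differ between states of a common cell
    (∀ (b b' : Fin 3 → ℝ) (hb : b ∈ stdSimplex ℝ (Fin 3)) (hb' : b' ∈ stdSimplex ℝ (Fin 3)),
      (∀ a o, (transformedSFR b' hb').Z a o = (perturbedSFR b hb).Z a o) ∧
      (∀ i j, (perturbedSFR b hb).ObsEquiv i j ↔ (i = 0 ↔ j = 0)) ∧
      (∀ i j, (transformedSFR b' hb').ObsEquiv i j ↔ (i = 0 ↔ j = 0)) ∧
      (∀ i j, (perturbedSFR b hb).FullRankObsEquiv i j ↔ (i = 0 ↔ j = 0)) ∧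
      (∀ i j, (transformedSFR b' hb').FullRankObsEquiv i j ↔ (i = 0 ↔ j = 0)) ∧
      (∀ σ : Equiv.Perm (Fin 3), ∃ i j, (i = 0 ↔ j = 0) ∧
        (transformedSFR b' hb').T .float' (σ i) (σ j) ≠ (perturbedSFR b hb).T .float' i j)) ∧
    -- under uniform random exploration both empirical Hankel matrices converge almost surely,
    -- entry by entry, to one and the same deterministic matrix, whatever the initial distributions
    ∃ H : List (SFRAction × Fin 2) → List (SFRAction × Fin 2) → ℝ,
      (∀ (b : Fin 3 → ℝ) (hb : b ∈ stdSimplex ℝ (Fin 3))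
        (Ω : Type*) [MeasurableSpace Ω] (μ : Measure Ω) [IsProbabilityMeasure μ]
        (st : ℕ → Ω → Fin 3) (act : ℕ → Ω → SFRAction) (obs : ℕ → Ω → Fin 2),
        (perturbedSFR b hb).IsUniformRun μ st act obs →
        ∀ᵐ ω ∂μ, ∀ hist test, Tendsto
          (fun n => empiricalHankel (fun t => act t ω) (fun t => obs t ω) n hist test)
          atTop (𝓝 (H hist test))) ∧
      (∀ (b' : Fin 3 → ℝ) (hb' : b' ∈ stdSimplex ℝ (Fin 3))
        (Ω : Type*) [MeasurableSpace Ω] (μ : Measure Ω) [IsProbabilityMeasure μ]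
        (st : ℕ → Ω → Fin 3) (act : ℕ → Ω → SFRAction) (obs : ℕ → Ω → Fin 2),
        (transformedSFR b' hb').IsUniformRun μ st act obs →
        ∀ᵐ ω ∂μ, ∀ hist test, Tendsto
          (fun n => empiricalHankel (fun t => act t ω) (fun t => obs t ω) n hist test)
          atTop (𝓝 (H hist test))) := by
  refine ⟨fun b b' hb hb' => ?_, ?_⟩
  · have hZ' : (transformedSFR b' hb').Z = sfrZ := by
      ext1 a
      ext1 o
      exact simP_conj_sfrZ a o
    have hT' : (transformedSFR b' hb').T .sense = 1 := by
      simp only [transformedSFR]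
      rw [sfrT_sense, Matrix.mul_one, simP_inv, simP_mul_inverse]
    have h1 := obsEquiv_of_Z_eq_sfrZ (M := perturbedSFR b hb) rfl sfrT_sense
    have h2 := obsEquiv_of_Z_eq_sfrZ hZ' hT'
    -- The diagonal position that `σ` sends to `(1, 1)` is a witness: its two indices agree, so they
    -- trivially share a cell.
    refine ⟨simP_conj_sfrZ, fun i j => (h1 i j).1, fun i j => (h2 i j).1, fun i j => (h1 i j).2,
      fun i j => (h2 i j).2, fun σ => ⟨σ.symm 1, σ.symm 1, Iff.rfl, ?_⟩⟩
    rw [Equiv.apply_symm_apply, transformedSFR_T_float'_one_one]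
    generalize σ.symm 1 = i
    fin_cases i <;> norm_num [perturbedSFR, sfrT]
  -- The initial distribution enters neither `weightMatrix` nor `windowValue`, so the limits are
  -- chosen once, from an arbitrary reference copy.
  · have hb₀ : (Pi.single 0 1 : Fin 3 → ℝ) ∈ stdSimplex ℝ (Fin 3) := single_mem_stdSimplex ℝ 0
    set M := perturbedSFR _ hb₀
    have : Nontrivial SFRAction := ⟨⟨.reset, .sense, by decide⟩⟩
    have hreset : ∀ i j, M.T .reset i = M.T .reset j := by
      intro i j
      ext k
      fin_cases i <;> fin_cases j <;> fin_cases k <;> rfl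
    choose p hp using fun w : List (SFRAction × Fin 2) => M.exists_mixesTo_of_reset hreset
      (M.windowValue (w.map fun b => Set.indicator {x | x = b} 1))
    refine ⟨fun hist test => p (hist ++ test) /
      (1 / (Fintype.card SFRAction : ℝ)) ^ (hist ++ test).length, ?_, ?_⟩
    · intro b hb Ω _ μ _ st act obs hrun
      have hval : ∀ l, (perturbedSFR b hb).windowValue l = M.windowValue l := fun l => by
        induction l with
        | nil => rfl
        | cons f l ih =>
          rw [POMDP.windowValue, ih]
          rfl
      refine hrun.ae_tendsto_empiricalHankel fun w => ?_
      rw [hval]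
      exact hp w
    · intro b' hb' Ω _ μ _ st act obs hrun
      refine hrun.ae_tendsto_empiricalHankel fun w => ?_
      rw [transformedSFR_windowValue hb₀ hb', transformedSFR_weightMatrix hb₀ hb']
      exact (hp w).conj simP_mem_rowStochastic simP_inv_mul_simP
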